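/- Let $\nu>-1$ be real and let $J_\nu(x)=\left(\frac x2\right)^{\nu}\sum_{m\ge 0}\frac{(-1)^m (x^2/4)^m}{m!\,\Gamma(\nu+m+1)}$, $x>0$, be the Bessel function of the first kind of order $\nu$. The positive zeros of $J_\nu$ form an infinite strictly increasing sequence $j_{\nu,1}<j_{\nu,2}<\cdots$, where $j_{\nu,n}$ denotes the $n$th positive zero, and for every integer $k\ge 1$, $$\sum_{n\ge 1,\ n\ne k}\frac{1}{j_{\nu,n}^2-j_{\nu,k}^2}=\frac{\nu+1}{2j_{\nu,k}^2},$$ where the series converges absolutely. -/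

import Mathlib

noncomputable section

/-- The Bessel function of the first kind of real order `ν`,
`J_ν(x) = (x/2)^ν ∑_{m ≥ 0} (-1)^m (x²/4)^m / (m! Γ(ν + m + 1))`.
It is only used for positive `x`, where the real power `(x/2)^ν` has its usual meaning. -/
def besselJ (ν x : ℝ) : ℝ :=
  (x / 2) ^ ν *
    ∑' m : ℕ, (-1 : ℝ) ^ m * (x ^ 2 / 4) ^ m / ((m.factorial : ℝ) * Real.Gamma (ν + m + 1))

/-- `besselZero ν n` is the `n`-th positive zero `j_{ν,n}` of `J_ν`, for `n ≥ 1`: `j_{ν,n+1}` is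
the smallest zero of `J_ν` that is larger than `j_{ν,n}`, starting from the convention
`j_{ν,0} = 0`. -/
def besselZero (ν : ℝ) : ℕ → ℝ
  | 0 => 0
  | n + 1 => sInf {x : ℝ | besselZero ν n < x ∧ besselJ ν x = 0}

end

open Filter Topology Metric Set

/-! Removing the factor `(x/2)^ν` and putting `z = x²` turns `J_ν` into an entire function `F` with
`z F'' + (ν+1) F' + F/4 = 0` and growth `O(exp(ε|z|))` for every `ε > 0`. Its zeros are positive and
simple: both facts come from an integral identity for the differential equation
(`eq_zero_of_hasDerivAt_rpow_mul`). For such functions the logarithmic derivative is the bare sum of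
the `1/(z - s)` over the zeros `s`, with no exponential correction
(`hasSum_logDeriv_of_pos_simple_zeros`).

Let `l` be a zero and `G = F/(z - l)`. The expansion of `G'/G` at `l` sums `1/(l - s)` over the
other zeros, while `G'(l)/G(l) = F''(l)/(2F'(l)) = -(ν+1)/(2l)` by the differential equation. With
`l = j_{ν,k}²` and a change of sign this is the identity.

The infinitude of the zeros follows from the same formulas: an empty expansion would force `F'(0) =
0`, and a largest zero would make a positive sum out of nonpositive terms. `HasSum` over the reals
is unconditional, which gives absolute convergence. -/

/-! ### Partial fractions of logarithmic derivatives -/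

/-- Borel–Carathéodory bounds a branch `k` of `log (g / g 0)` by `2M` on `|w| ≤ R/2`; Cauchy's
estimate on a circle of radius `R/4` then gives `8M/R`. -/
theorem norm_logDeriv_le_of_ne_zero_of_norm_le {g : ℂ → ℂ} {R M : ℝ} (hR : 0 < R) (hM : 0 < M)
    (hg : DifferentiableOn ℂ g (ball 0 R)) (h0 : ∀ z ∈ ball (0 : ℂ) R, g z ≠ 0)
    (hb : ∀ z ∈ ball (0 : ℂ) R, ‖g z‖ ≤ Real.exp M * ‖g 0‖) {z : ℂ} (hz : ‖z‖ ≤ R / 4) :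
    ‖logDeriv g z‖ ≤ 8 * M / R := by
  have hd : DifferentiableOn ℂ (logDeriv g) (ball 0 R) := (hg.deriv isOpen_ball).div hg h0
  obtain ⟨h, hh⟩ := hd.isExactOn_ball
  set k : ℂ → ℂ := fun w => h w - h 0 with hk
  have hk' : ∀ w ∈ ball (0 : ℂ) R, HasDerivAt k (logDeriv g w) w := fun w hw =>
    (hh w hw).sub_const _
  have hkd : DifferentiableOn ℂ k (ball 0 R) := fun w hw =>
    (hk' w hw).differentiableAt.differentiableWithinAt
  have hexp : ∀ w ∈ ball (0 : ℂ) R, g w = g 0 * Complex.exp (k w) := by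
    have hlog : EqOn (logDeriv g) (logDeriv fun w => Complex.exp (k w)) (ball 0 R) := by
      intro w hw
      rw [logDeriv_apply (fun w => Complex.exp (k w)), (hk' w hw).cexp.deriv]
      field_simp [Complex.exp_ne_zero]
    obtain ⟨c, -, hc⟩ := (logDeriv_eqOn_iff hg hkd.cexp isOpen_ball
      (convex_ball _ _).isPreconnected (fun w _ => Complex.exp_ne_zero _) h0).1 hlog
    have hc0 : g 0 = c := by simpa [hk] using hc (mem_ball_self hR)
    intro w hw
    rw [hc hw, hc0]; rfl
  have hre : MapsTo k (ball 0 R) {w | w.re ≤ M} := by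
    intro w hw
    have h1 := hb w hw
    rw [hexp w hw, norm_mul, Complex.norm_exp, mul_comm] at h1
    exact Real.exp_le_exp.1 (le_of_mul_le_mul_right h1 (norm_pos_iff.2 (h0 0 (mem_ball_self hR))))
  have hzb : closedBall z (R / 4) ⊆ closedBall 0 (R / 2) := by
    apply closedBall_subset_closedBall'
    rw [dist_zero_right]; linarith
  have hlt : closedBall (0 : ℂ) (R / 2) ⊆ ball 0 R := closedBall_subset_ball (by linarith)
  have hbd : ∀ w ∈ sphere z (R / 4), ‖k w‖ ≤ 2 * M := by
    intro w hw
    have hw2 := hzb (sphere_subset_closedBall hw)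
    have hw1 : ‖w‖ ≤ R / 2 := by simpa using hw2
    refine (Complex.borelCaratheodory_zero hM hkd hre hR (hlt hw2) (by simp [hk])).trans ?_
    rw [div_le_iff₀ (by linarith)]
    nlinarith
  have := Complex.norm_deriv_le_of_forall_mem_sphere_norm_le (f := k) (by positivity : 0 < R / 4)
    ((hkd.mono (hzb.trans hlt)).diffContOnCl_ball (subset_refl _)) hbd
  rw [(hk' z (hlt (hzb (mem_closedBall_self (by positivity))))).deriv] at this
  refine this.trans (le_of_eq ?_)
  field_simp
  ring

theorem exists_dslope_factor {F : ℂ → ℂ} (hF : Differentiable ℂ F)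
    (hs : ∀ z, F z = 0 → deriv F z ≠ 0) {a : ℂ} (ha : F a = 0) :
    Differentiable ℂ (dslope F a) ∧ (∀ z, F z = (z - a) * dslope F a z) ∧
      (∀ z, dslope F a z = 0 → deriv (dslope F a) z ≠ 0) ∧
      ∀ z, dslope F a z = 0 ↔ F z = 0 ∧ z ≠ a := by
  have hd : Differentiable ℂ (dslope F a) := by
    rw [← differentiableOn_univ]
    exact (Complex.differentiableOn_dslope univ_mem).2 hF.differentiableOn
  have hf : ∀ z, F z = (z - a) * dslope F a z := fun z => by
    rw [← smul_eq_mul, sub_smul_dslope, ha, sub_zero]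
  have hda : dslope F a a ≠ 0 := by rw [dslope_same]; exact hs a ha
  have hz : ∀ z, dslope F a z = 0 ↔ F z = 0 ∧ z ≠ a := by
    intro z
    constructor
    · intro h
      refine ⟨by rw [hf, h, mul_zero], ?_⟩
      rintro rfl
      exact hda h
    · rintro ⟨h, hne⟩
      rw [hf] at h
      exact (mul_eq_zero.1 h).resolve_left (sub_ne_zero.2 hne)
  refine ⟨hd, hf, fun z h0 h1 => ?_, hz⟩
  refine hs z ((hz z).1 h0).1 ?_
  have h2 : HasDerivAt (fun w => (w - a) * dslope F a w)
      (1 * dslope F a z + (z - a) * deriv (dslope F a) z) z :=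
    ((hasDerivAt_id z).sub_const a).mul (hd z).hasDerivAt
  rw [funext hf, h2.deriv, h0, h1]
  simp

theorem exists_factor_prod_of_simple_zeros {F : ℂ → ℂ} (hF : Differentiable ℂ F)
    (hs : ∀ z, F z = 0 → deriv F z ≠ 0) (S : Finset ℂ) (hS : ∀ s ∈ S, F s = 0) :
    ∃ g : ℂ → ℂ, Differentiable ℂ g ∧ (∀ z, F z = (∏ s ∈ S, (z - s)) * g z) ∧
      (∀ z, g z = 0 → deriv g z ≠ 0) ∧ ∀ z, g z = 0 ↔ F z = 0 ∧ z ∉ S := by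
  induction S using Finset.induction_on with
  | empty => exact ⟨F, hF, by simp, hs, by simp⟩
  | insert a S ha ih =>
    obtain ⟨g, hg, hfac, hgs, hz⟩ := ih fun s h => hS s (Finset.mem_insert_of_mem h)
    have hga : g a = 0 := (hz a).2 ⟨hS a (Finset.mem_insert_self _ _), ha⟩
    obtain ⟨h1, h2, h3, h4⟩ := exists_dslope_factor hg hgs hga
    refine ⟨dslope g a, h1, fun z => ?_, h3, fun z => ?_⟩
    · rw [Finset.prod_insert ha, hfac, h2]; ring
    · rw [h4, hz, Finset.mem_insert]; tauto

/-- Divide out the zeros in `|s| < R`. On `|w| = 2R` each factor satisfies `|w - s| ≥ R > |s|`, so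
the quotient `g` inherits the bound relative to `g 0`, and the maximum principle carries it inward.
-/
theorem norm_logDeriv_sub_sum_le {F : ℂ → ℂ} (hF : Differentiable ℂ F)
    (hs : ∀ z, F z = 0 → deriv F z ≠ 0) (h0 : F 0 ≠ 0) {R M : ℝ} (hR : 0 < R) (hM : 0 < M)
    (hb : ∀ z, ‖z‖ = 2 * R → ‖F z‖ ≤ Real.exp M * ‖F 0‖)
    (S : Finset ℂ) (hS : ∀ s, s ∈ S ↔ F s = 0 ∧ ‖s‖ < R) {z : ℂ} (hz : ‖z‖ ≤ R / 4)
    (hFz : F z ≠ 0) :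
    ‖logDeriv F z - ∑ s ∈ S, 1 / (z - s)‖ ≤ 8 * M / R := by
  obtain ⟨g, hg, hfac, -, hgz⟩ := exists_factor_prod_of_simple_zeros hF hs S
    fun s h => ((hS s).1 h).1
  have hgne : ∀ w ∈ ball (0 : ℂ) R, g w ≠ 0 := by
    intro w hw h
    rw [hgz, hS] at h
    exact h.2 ⟨h.1, by simpa using hw⟩
  have hsph : ∀ w ∈ sphere (0 : ℂ) (2 * R), ‖g w‖ ≤ Real.exp M * ‖g 0‖ := by
    intro w hw
    have hw' : ‖w‖ = 2 * R := by simpa using hw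
    have h1 := hb w hw'
    rw [hfac, hfac 0, norm_mul, norm_mul, norm_prod, norm_prod] at h1
    have hle : ∏ s ∈ S, ‖0 - s‖ ≤ ∏ s ∈ S, ‖w - s‖ := by
      refine Finset.prod_le_prod (fun _ _ => norm_nonneg _) fun s h => ?_
      have := norm_sub_norm_le w s
      have := ((hS s).1 h).2
      rw [zero_sub, norm_neg]
      linarith
    have hpos : 0 < ∏ s ∈ S, ‖0 - s‖ := by
      refine Finset.prod_pos fun s h => ?_
      rw [zero_sub, norm_neg, norm_pos_iff]
      rintro rfl
      exact h0 ((hS 0).1 h).1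
    refine le_of_mul_le_mul_left ?_ hpos
    calc _ ≤ (∏ s ∈ S, ‖w - s‖) * ‖g w‖ := by gcongr
      _ ≤ _ := h1
      _ = _ := by ring
  have hball : ∀ w ∈ ball (0 : ℂ) R, ‖g w‖ ≤ Real.exp M * ‖g 0‖ := by
    intro w hw
    refine Complex.norm_le_of_forall_mem_frontier_norm_le (U := ball 0 (2 * R)) isBounded_ball
      hg.diffContOnCl ?_ (subset_closure (ball_subset_ball (by linarith) hw))
    rw [frontier_ball _ (by positivity)]
    exact hsph
  have hzR : z ∈ ball (0 : ℂ) R := by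
    rw [mem_ball_zero_iff]; linarith
  have hne : ∀ s ∈ S, z - s ≠ 0 := by
    intro s h h'
    rw [sub_eq_zero.1 h'] at hFz
    exact hFz ((hS s).1 h).1
  have hlog : logDeriv F z = ∑ s ∈ S, 1 / (z - s) + logDeriv g z := by
    rw [funext hfac, logDeriv_mul z (Finset.prod_ne_zero_iff.2 hne) (hgne z hzR)
      (by fun_prop) (hg z), logDeriv_prod hne (fun _ _ => by fun_prop)]
    congr 1
    refine Finset.sum_congr rfl fun s _ => ?_
    rw [logDeriv_apply, deriv_sub_const]
    simp
  rw [hlog, add_sub_cancel_left]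
  exact norm_logDeriv_le_of_ne_zero_of_norm_le hR hM hg.differentiableOn hgne hball hz

theorem finite_zeros_norm_lt {F : ℂ → ℂ} (hF : Differentiable ℂ F) (h0 : F 0 ≠ 0) (R : ℝ) :
    {s | F s = 0 ∧ ‖s‖ < R}.Finite := by
  by_contra hinf
  obtain ⟨a, -, ha⟩ := Set.Infinite.exists_accPt_of_subset_isCompact hinf
    (isCompact_closedBall (0 : ℂ) R) (fun s hs => by simpa using hs.2.le)
  have hfr : ∃ᶠ z in 𝓝[≠] a, F z = (fun _ => 0) z :=
    (accPt_iff_frequently_nhdsNE.1 ha).mono fun z hz => hz.1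
  have han : AnalyticOnNhd ℂ F univ := fun z _ => hF.analyticAt z
  exact h0 (congrFun (han.eq_of_frequently_eq (fun z _ => analyticAt_const) hfr) 0)

/-- The partial fraction expansion of the logarithmic derivative of an entire function of order
less than one or of minimal exponential type, in the case of simple positive zeros. -/
theorem hasSum_logDeriv_of_pos_simple_zeros {F : ℂ → ℂ} (hF : Differentiable ℂ F)
    (hs : ∀ z, F z = 0 → deriv F z ≠ 0) (h0 : F 0 ≠ 0)
    (hpos : ∀ z, F z = 0 → ∃ x : ℝ, 0 < x ∧ z = x)
    (hgr : ∀ ε > 0, ∃ C : ℝ, ∀ z, ‖F z‖ ≤ C * Real.exp (ε * ‖z‖)) {z : ℂ} (hz : F z ≠ 0) :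
    HasSum (fun s : {s : ℂ // F s = 0} => 1 / (z - s)) (logDeriv F z) := by
  classical
  have hfin : ∀ R : ℝ, {s : {s : ℂ // F s = 0} | ‖(s : ℂ)‖ < R}.Finite := fun R =>
    ((finite_zeros_norm_lt hF h0 R).preimage Subtype.val_injective.injOn).subset
      fun s h => ⟨s.2, h⟩
  set S : ℝ → Finset {s : ℂ // F s = 0} := fun R => (hfin R).toFinset with hSdef
  have hStop : Tendsto S atTop atTop := by
    refine tendsto_atTop_finset_of_monotone (fun a b hab s h => ?_) fun s => ⟨‖(s : ℂ)‖ + 1, ?_⟩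
    · simp only [hSdef, Finite.mem_toFinset, mem_ofPred_eq] at h ⊢
      linarith
    · simp [hSdef]
  have key : ∀ w, F w ≠ 0 → Tendsto (fun R => ∑ s ∈ S R, 1 / (w - s)) atTop
      (𝓝 (logDeriv F w)) := by
    intro w hw
    rw [Metric.tendsto_atTop]
    intro ε hε
    obtain ⟨C, hC⟩ := hgr (ε / 64) (by positivity)
    set A : ℝ := |Real.log (|C| / ‖F 0‖)| + 1 with hA
    have hApos : 0 < A := by positivity
    clear_value A
    -- The error is `8(A + εR/32)/R = 8A/R + ε/4`, and `R ≥ 32A/ε` makes it at most `ε/2`.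
    refine ⟨max (max 1 (4 * ‖w‖)) (32 * A / ε), fun R hR => ?_⟩
    have hR1 : 1 ≤ R := (le_max_left _ _).trans ((le_max_left _ _).trans hR)
    have hR2 : 4 * ‖w‖ ≤ R := (le_max_right _ _).trans ((le_max_left _ _).trans hR)
    have hR3 : 32 * A / ε ≤ R := (le_max_right _ _).trans hR
    have hR0 : 0 < R := by linarith
    have hF0 : 0 < ‖F 0‖ := norm_pos_iff.2 h0
    have hCpos : 0 < |C| := by
      refine abs_pos.2 fun h => ?_
      have := hC 0
      rw [h, zero_mul] at this
      linarith
    have hbound : ∀ v : ℂ, ‖v‖ = 2 * R → ‖F v‖ ≤ Real.exp (A + ε / 32 * R) * ‖F 0‖ := by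
      intro v hv
      have h1 : |C| / ‖F 0‖ ≤ Real.exp A := by
        rw [← Real.log_le_iff_le_exp (by positivity)]
        exact (le_abs_self _).trans (by linarith)
      rw [div_le_iff₀ hF0] at h1
      calc ‖F v‖ ≤ C * Real.exp (ε / 64 * ‖v‖) := hC v
        _ ≤ |C| * Real.exp (ε / 32 * R) := by
          rw [hv, show ε / 64 * (2 * R) = ε / 32 * R by ring]
          gcongr
          exact le_abs_self _
        _ ≤ (Real.exp A * ‖F 0‖) * Real.exp (ε / 32 * R) := by gcongr
        _ = _ := by rw [Real.exp_add]; ring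
    have := norm_logDeriv_sub_sum_le hF hs h0 hR0 (by positivity) hbound
      ((S R).map (Function.Embedding.subtype _)) (fun s => by simp [hSdef, and_comm]) (z := w)
      (by linarith) hw
    rw [Finset.sum_map] at this
    rw [dist_comm, dist_eq_norm]
    refine this.trans_lt ?_
    rw [div_lt_iff₀ hR0]
    rw [div_le_iff₀ hε] at hR3
    nlinarith [mul_pos hε hR0]
  -- At `z = 0` all terms are negative reals, so convergence of the sums over discs already yields
  -- absolute summability.
  have hnorm : ∀ s : {s : ℂ // F s = 0}, 1 / (0 - (s : ℂ)) = ((-(1 / ‖(s : ℂ)‖) : ℝ) : ℂ) := by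
    rintro ⟨s, h⟩
    obtain ⟨x, hx, rfl⟩ := hpos s h
    simp [abs_of_pos hx]
  have hsum0 : Summable fun s : {s : ℂ // F s = 0} => 1 / ‖(s : ℂ)‖ := by
    refine summable_of_sum_le (c := ‖logDeriv F 0‖ + 1) (fun _ => by positivity) fun T => ?_
    have h1 := ((key 0 h0).norm.eventually_lt_const (lt_add_one ‖logDeriv F 0‖)).and
      (hStop.eventually_ge_atTop T)
    obtain ⟨R, hR1, hR2⟩ := h1.exists
    refine le_trans (Finset.sum_le_sum_of_subset_of_nonneg hR2 fun _ _ _ => by positivity) ?_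
    refine le_trans ?_ hR1.le
    simp_rw [hnorm]
    rw [← Complex.ofReal_sum, Complex.norm_real, Finset.sum_neg_distrib, norm_neg]
    exact le_abs_self _
  have hsum : Summable fun s : {s : ℂ // F s = 0} => 1 / (z - s) := by
    refine Summable.of_norm_bounded_eventually (hsum0.mul_left 2) ?_
    rw [Filter.eventually_cofinite]
    refine (hfin (2 * ‖z‖ + 1)).subset fun s h => ?_
    simp only [mem_ofPred_eq, not_le] at h ⊢
    by_contra! hle
    refine h.not_ge ?_
    have h2 := norm_sub_norm_le (s : ℂ) z
    rw [norm_sub_rev] at h2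
    have h3 : 0 < ‖(s : ℂ)‖ := by linarith [norm_nonneg z]
    rw [norm_div, norm_one, mul_one_div, div_le_div_iff₀ (by linarith) h3]
    linarith
  have := tendsto_nhds_unique (hsum.hasSum.comp hStop) (key z hz)
  rw [← this]
  exact hsum.hasSum

/-! ### The entire function behind `J_ν`: growth, recurrence, differential equation -/

/-- The coefficients of the entire function `z ↦ (√z / 2)^(-ν) J_ν(√z)`. -/
noncomputable def besselCoeff (ν : ℝ) (m : ℕ) : ℝ :=
  (-1 / 4) ^ m / ((m.factorial : ℝ) * Real.Gamma (ν + m + 1))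

/-- The entire function `z ↦ (√z / 2)^(-ν) J_ν(√z)`. -/
noncomputable def besselEntire (ν : ℝ) (z : ℂ) : ℂ := ∑' m : ℕ, (besselCoeff ν m : ℂ) * z ^ m

section Series

variable {c : ℕ → ℝ}

theorem norm_coeff_mul_pow_le {ε C : ℝ} (hC : ∀ m, |c m| ≤ C * (ε ^ m / m.factorial)) (z : ℂ)
    (m : ℕ) : ‖(c m : ℂ) * z ^ m‖ ≤ C * ((ε * ‖z‖) ^ m / m.factorial) := by
  rw [norm_mul, norm_pow, Complex.norm_real, Real.norm_eq_abs]
  calc _ ≤ C * (ε ^ m / m.factorial) * ‖z‖ ^ m := by gcongr; exact hC m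
    _ = _ := by rw [mul_pow]; ring

theorem norm_tsum_coeff_mul_pow_le {ε C : ℝ} (hC : ∀ m, |c m| ≤ C * (ε ^ m / m.factorial))
    (z : ℂ) : ‖∑' m, (c m : ℂ) * z ^ m‖ ≤ C * Real.exp (ε * ‖z‖) := by
  have h := (NormedSpace.expSeries_div_hasSum_exp (ε * ‖z‖)).mul_left C
  rw [← Real.exp_eq_exp_ℝ] at h
  exact tsum_of_norm_bounded h (norm_coeff_mul_pow_le hC z)

theorem summable_norm_coeff_mul_pow {ε C : ℝ} (hC : ∀ m, |c m| ≤ C * (ε ^ m / m.factorial))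
    (z : ℂ) : Summable fun m => ‖(c m : ℂ) * z ^ m‖ :=
  .of_nonneg_of_le (fun _ => norm_nonneg _) (norm_coeff_mul_pow_le hC z)
    ((Real.summable_pow_div_factorial _).mul_left C)

theorem hasDerivAt_tsum_coeff_mul_pow {ε C : ℝ} (hC : ∀ m, |c m| ≤ C * (ε ^ m / m.factorial))
    (z : ℂ) : HasDerivAt (fun w => ∑' m, (c m : ℂ) * w ^ m)
      (∑' m, (c (m + 1) * (m + 1) : ℂ) * z ^ m) z := by
  set R : ℝ := ‖z‖ + 1 with hR
  have hR0 : 0 ≤ R := by positivity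
  have hzR : z ∈ ball (0 : ℂ) R := by simp [hR]
  have hu : Summable fun m => ‖(c m : ℂ) * (R : ℂ) ^ m‖ := summable_norm_coeff_mul_pow hC _
  have hle : ∀ (m : ℕ) (w : ℂ), w ∈ ball (0 : ℂ) R →
      ‖(c m : ℂ) * w ^ m‖ ≤ ‖(c m : ℂ) * (R : ℂ) ^ m‖ := by
    intro m w hw
    have hw' : ‖w‖ ≤ R := by simpa using (mem_ball_zero_iff.1 hw).le
    rw [norm_mul, norm_mul, norm_pow, norm_pow, Complex.norm_real R, Real.norm_of_nonneg hR0]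
    gcongr
  have hd : ∀ m : ℕ, DifferentiableOn ℂ (fun w : ℂ => (c m : ℂ) * w ^ m) (ball 0 R) :=
    fun m => by fun_prop
  have h1 := (Complex.differentiableOn_tsum_of_summable_norm hu hd isOpen_ball hle).differentiableAt
    (isOpen_ball.mem_nhds hzR)
  have h2 := Complex.hasSum_deriv_of_summable_norm hu hd isOpen_ball hle hzR
  rw [← hasSum_nat_add_iff' 1] at h2
  simp only [Finset.range_one, Finset.sum_singleton, pow_zero, deriv_const, sub_zero] at h2
  refine h1.hasDerivAt.congr_deriv (h2.tsum_eq.symm.trans (tsum_congr fun m => ?_))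
  simp
  ring

end Series

theorem besselCoeff_bound {ν : ℝ} (hν : -1 < ν) {ε : ℝ} (hε : 0 < ε) :
    ∃ C : ℝ, ∀ m, |besselCoeff ν m| ≤ C * (ε ^ m / m.factorial) := by
  have hpos : ∀ m : ℕ, 0 < ν + m + 1 := fun m => by
    have : (0 : ℝ) ≤ m := m.cast_nonneg
    linarith
  have hG : ∀ m : ℕ, 0 < Real.Gamma (ν + m + 1) := fun m => Real.Gamma_pos_of_pos (hpos m)
  -- Since `1/4 = xε`, the bound splits as `x^m / Γ(ν+m+1)` times `ε^m / m!`; the first factor is at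
  -- most its sum over `m`.
  set x : ℝ := 1 / (4 * ε) with hx
  have hx0 : 0 < x := by positivity
  have hterm : ∀ m : ℕ, 0 < x ^ m / Real.Gamma (ν + m + 1) := fun m =>
    div_pos (pow_pos hx0 m) (hG m)
  have hsum : Summable fun m : ℕ => x ^ m / Real.Gamma (ν + m + 1) := by
    refine summable_of_ratio_test_tendsto_lt_one (l := 0) one_pos
      (Eventually.of_forall fun m => (hterm m).ne') ?_
    have : ∀ m : ℕ, ‖x ^ (m + 1) / Real.Gamma (ν + (m + 1 : ℕ) + 1)‖ /
        ‖x ^ m / Real.Gamma (ν + m + 1)‖ = x / (m + (ν + 1)) := by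
      intro m
      rw [Real.norm_of_nonneg (hterm _).le, Real.norm_of_nonneg (hterm _).le]
      have h1 : Real.Gamma (ν + (m + 1 : ℕ) + 1) = (ν + m + 1) * Real.Gamma (ν + m + 1) := by
        rw [← Real.Gamma_add_one (hpos m).ne']
        push_cast
        congr 1
        ring
      have h2 := (hpos m).ne'
      have h3 := (hG m).ne'
      have h4 : (m : ℝ) + (ν + 1) ≠ 0 := by rwa [← add_assoc, add_comm (m : ℝ)]
      rw [h1, pow_succ]
      field_simp
      ring
    simp_rw [this]
    exact tendsto_const_nhds.div_atTop
      (tendsto_atTop_add_const_right _ _ tendsto_natCast_atTop_atTop)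
  refine ⟨∑' m : ℕ, x ^ m / Real.Gamma (ν + m + 1), fun m => ?_⟩
  have h1 := hsum.le_tsum m fun i _ => (hterm i).le
  have h2 : |besselCoeff ν m| = x ^ m / Real.Gamma (ν + m + 1) * (ε ^ m / m.factorial) := by
    rw [besselCoeff, abs_div, abs_pow, abs_of_pos (mul_pos (by positivity) (hG m)), hx]
    have := (hG m).ne'
    rw [show |(-1 / 4 : ℝ)| = 1 / (4 * ε) * ε by
      rw [abs_of_neg (by norm_num)]; field_simp, mul_pow]
    field_simp
  rw [h2]
  gcongr

theorem besselCoeff_succ_mul (ν : ℝ) (m : ℕ) :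
    besselCoeff ν (m + 1) * (m + 1) = -1 / 4 * besselCoeff (ν + 1) m := by
  have h : ν + ((m + 1 : ℕ) : ℝ) + 1 = ν + 1 + m + 1 := by push_cast; ring
  rw [besselCoeff, besselCoeff, h, Nat.factorial_succ, pow_succ]
  have : (m : ℝ) + 1 ≠ 0 := by positivity
  push_cast
  field_simp

theorem hasDerivAt_besselEntire {ν : ℝ} (hν : -1 < ν) (z : ℂ) :
    HasDerivAt (besselEntire ν) (-1 / 4 * besselEntire (ν + 1) z) z := by
  obtain ⟨C, hC⟩ := besselCoeff_bound hν one_pos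
  refine (hasDerivAt_tsum_coeff_mul_pow hC z).congr_deriv ?_
  rw [besselEntire, ← tsum_mul_left]
  refine tsum_congr fun m => ?_
  rw [← mul_assoc]
  congr 1
  exact_mod_cast besselCoeff_succ_mul ν m

theorem differentiable_besselEntire {ν : ℝ} (hν : -1 < ν) : Differentiable ℂ (besselEntire ν) :=
  fun z => (hasDerivAt_besselEntire hν z).differentiableAt

theorem deriv_besselEntire {ν : ℝ} (hν : -1 < ν) :
    deriv (besselEntire ν) = fun z => -1 / 4 * besselEntire (ν + 1) z :=
  funext fun z => (hasDerivAt_besselEntire hν z).deriv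

theorem summable_besselEntire {ν : ℝ} (hν : -1 < ν) (z : ℂ) :
    Summable fun m => (besselCoeff ν m : ℂ) * z ^ m := by
  obtain ⟨C, hC⟩ := besselCoeff_bound hν one_pos
  exact (summable_norm_coeff_mul_pow hC z).of_norm

theorem norm_besselEntire_le {ν : ℝ} (hν : -1 < ν) {ε : ℝ} (hε : 0 < ε) :
    ∃ C : ℝ, ∀ z, ‖besselEntire ν z‖ ≤ C * Real.exp (ε * ‖z‖) := by
  obtain ⟨C, hC⟩ := besselCoeff_bound hν hε
  exact ⟨C, norm_tsum_coeff_mul_pow_le hC⟩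

theorem besselCoeff_zero {ν : ℝ} (hν : -1 < ν) :
    besselCoeff ν 0 = (ν + 1) * besselCoeff (ν + 1) 0 := by
  have h0 : ν + 1 ≠ 0 := by linarith
  simp only [besselCoeff, pow_zero, Nat.factorial_zero, Nat.cast_one, Nat.cast_zero, add_zero,
    one_mul]
  rw [Real.Gamma_add_one h0]
  field_simp

theorem besselCoeff_succ {ν : ℝ} (hν : -1 < ν) (m : ℕ) :
    besselCoeff ν (m + 1) =
      (ν + 1) * besselCoeff (ν + 1) (m + 1) - 1 / 4 * besselCoeff (ν + 2) m := by
  have hm : (0 : ℝ) ≤ m := m.cast_nonneg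
  have h0 : 0 < ν + 1 + m + 1 := by linarith
  have e1 : ν + ((m + 1 : ℕ) : ℝ) + 1 = ν + 1 + m + 1 := by push_cast; ring
  have e2 : ν + 1 + ((m + 1 : ℕ) : ℝ) + 1 = ν + 1 + m + 1 + 1 := by push_cast; ring
  have e3 : ν + 2 + (m : ℝ) + 1 = ν + 1 + m + 1 + 1 := by ring
  have hG := (Real.Gamma_pos_of_pos h0).ne'
  rw [besselCoeff, besselCoeff, besselCoeff, e1, e2, e3, Real.Gamma_add_one h0.ne',
    Nat.factorial_succ, pow_succ]
  have : (m : ℝ) + 1 ≠ 0 := by positivity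
  have h1 := h0.ne'
  push_cast
  field_simp
  ring

/-- The three-term Bessel recurrence; as differentiation raises `ν` by one up to the factor `-1/4`,
it is the differential equation in disguise. -/
theorem besselEntire_eq {ν : ℝ} (hν : -1 < ν) (z : ℂ) :
    besselEntire ν z =
      (ν + 1) * besselEntire (ν + 1) z - z / 4 * besselEntire (ν + 2) z := by
  have h0 := summable_besselEntire hν z
  have h1 := summable_besselEntire (show -1 < ν + 1 by linarith) z
  have h2 := summable_besselEntire (show -1 < ν + 2 by linarith) z
  rw [besselEntire, besselEntire, h0.tsum_eq_zero_add, h1.tsum_eq_zero_add, besselEntire, mul_add,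
    ← tsum_mul_left, ← tsum_mul_left, add_sub_assoc, ← Summable.tsum_sub
      (((summable_nat_add_iff 1).2 h1).mul_left _) (h2.mul_left _)]
  congr 1
  · rw [besselCoeff_zero hν]; push_cast; ring
  · refine tsum_congr fun m => ?_
    rw [besselCoeff_succ hν]; push_cast; ring

theorem besselEntire_ode {ν : ℝ} (hν : -1 < ν) (z : ℂ) :
    z * deriv (deriv (besselEntire ν)) z + (ν + 1) * deriv (besselEntire ν) z +
      besselEntire ν z / 4 = 0 := by
  rw [deriv_besselEntire hν, deriv_const_mul_field, deriv_besselEntire (by linarith),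
    besselEntire_eq hν, add_assoc ν 1 1, one_add_one_eq_two]
  ring

theorem besselEntire_ofReal (ν x : ℝ) :
    besselEntire ν x = ((∑' m, besselCoeff ν m * x ^ m : ℝ) : ℂ) := by
  rw [besselEntire]; push_cast; rfl

/-! ### Positivity and simplicity of the zeros -/

theorem re_besselEntire_pos_of_nonpos {ν : ℝ} (hν : -1 < ν) {x : ℝ} (hx : x ≤ 0) :
    0 < (besselEntire ν x).re := by
  have hpos : ∀ m : ℕ, 0 < Real.Gamma (ν + m + 1) := fun m => Real.Gamma_pos_of_pos (by
    have : (0 : ℝ) ≤ m := m.cast_nonneg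
    linarith)
  rw [besselEntire_ofReal, Complex.ofReal_re]
  refine Summable.tsum_pos (i := 0) ?_ (fun m => ?_) ?_
  · exact_mod_cast summable_besselEntire hν x
  · rw [besselCoeff, div_mul_eq_mul_div, ← mul_pow]
    exact div_nonneg (pow_nonneg (by linarith) m) (mul_pos (by positivity) (hpos m)).le
  · have := hpos 0
    rw [besselCoeff]
    simp only [pow_zero, Nat.factorial_zero, Nat.cast_one, one_mul, mul_one]
    positivity

theorem besselEntire_zero_ne_zero {ν : ℝ} (hν : -1 < ν) : besselEntire ν 0 ≠ 0 := by
  intro h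
  have := re_besselEntire_pos_of_nonpos hν le_rfl
  rw [Complex.ofReal_zero, h] at this
  simp at this

/-- If `t^(ν+1) p(t)` has derivative `t^ν g(t)` with `g ≥ 0`, and `p(a) = 0` for some `a > 0`, then
`g(0) = 0`. -/
theorem eq_zero_of_hasDerivAt_rpow_mul {ν a : ℝ} (hν : -1 < ν) (ha : 0 < a) {p g : ℝ → ℝ}
    (hp : Continuous p) (hg : Continuous g) (hg0 : ∀ t, 0 ≤ g t)
    (hd : ∀ t, 0 < t → HasDerivAt (fun t => t ^ (ν + 1) * p t) (t ^ ν * g t) t)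
    (hpa : p a = 0) : g 0 = 0 := by
  set w : ℝ → ℝ := fun t => t ^ (ν + 1) * p t with hw
  have hcont : ContinuousOn w (Icc 0 a) :=
    ((Real.continuous_rpow_const (by linarith)).mul hp).continuousOn
  have hmono : MonotoneOn w (Icc 0 a) := by
    refine monotoneOn_of_deriv_nonneg (convex_Icc 0 a) hcont ?_ ?_
    · rw [interior_Icc]
      exact fun t ht => (hd t ht.1).differentiableAt.differentiableWithinAt
    · rw [interior_Icc]
      intro t ht
      rw [(hd t ht.1).deriv]
      exact mul_nonneg (Real.rpow_nonneg ht.1.le _) (hg0 t)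
  have hw0 : w 0 = 0 := by simp [hw, Real.zero_rpow (by linarith : ν + 1 ≠ 0)]
  have hwa : w a = 0 := by simp [hw, hpa]
  -- A monotone function vanishing at both ends vanishes in between; `ν > -1` is what gives `w 0 =
  -- 0`.
  have hzero : ∀ t ∈ Ioo 0 a, w t = 0 := by
    intro t ht
    have h1 := hmono (left_mem_Icc.2 ha.le) (Ioo_subset_Icc_self ht) ht.1.le
    have h2 := hmono (Ioo_subset_Icc_self ht) (right_mem_Icc.2 ha.le) ht.2.le
    linarith
  have hgz : ∀ t ∈ Ioo 0 a, g t = 0 := by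
    intro t ht
    have h1 : HasDerivAt w 0 t := (hasDerivAt_const t (0 : ℝ)).congr_of_eventuallyEq
      (Filter.eventuallyEq_of_mem (isOpen_Ioo.mem_nhds ht) hzero)
    have h2 := (hd t ht.1).unique h1
    exact (mul_eq_zero.1 h2).resolve_left (Real.rpow_pos_of_pos ht.1 _).ne'
  have hcl : (0 : ℝ) ∈ closure (Ioo 0 a) := by
    rw [closure_Ioo ha.ne]
    exact left_mem_Icc.2 ha.le
  have := (isClosed_singleton.preimage hg).closure_subset_iff.2 (fun t ht => hgz t ht) hcl
  simpa using this

theorem im_eq_zero_of_besselEntire_eq_zero {ν : ℝ} (hν : -1 < ν) {l : ℂ}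
    (hl : besselEntire ν l = 0) : l.im = 0 := by
  by_contra him
  set F := besselEntire ν with hF
  have hFd : Differentiable ℂ F := differentiable_besselEntire hν
  have hFd' : Differentiable ℂ (deriv F) := hFd.deriv
  -- Lagrange's identity on the ray `t ↦ t l`: up to normalisation `p` is the Wronskian of `F(tl)`
  -- and its conjugate, so `(t^(ν+1) p)' = t^ν |F(tl)|²`.
  set p : ℝ → ℝ := fun t =>
    -4 / l.im * (l * deriv F (t * l) * (starRingEnd ℂ) (F (t * l))).im with hp
  have hFc := hFd.continuous
  have hFc' := hFd'.continuous
  refine (?_ : Complex.normSq (F ((0 : ℝ) * l)) ≠ 0)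
    (eq_zero_of_hasDerivAt_rpow_mul (p := p) (g := fun t => Complex.normSq (F ((t : ℝ) * l)))
      hν one_pos ?_ ?_ (fun t => Complex.normSq_nonneg _) ?_ ?_)
  · simpa using besselEntire_zero_ne_zero hν
  · have := Complex.continuous_conj
    fun_prop
  · exact Complex.continuous_normSq.comp (by fun_prop)
  · intro t ht
    have hm : HasDerivAt (fun t : ℝ => (t : ℂ) * l) l t := by
      simpa using (Complex.ofRealCLM.hasDerivAt (x := t)).mul_const l
    have h1 : HasDerivAt (fun t : ℝ => F (t * l)) (deriv F (t * l) * l) t :=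
      (hFd _).hasDerivAt.comp t hm
    have h2 : HasDerivAt (fun t : ℝ => deriv F (t * l)) (deriv (deriv F) (t * l) * l) t :=
      (hFd' _).hasDerivAt.comp t hm
    have h3 := (h2.const_mul l).mul h1.star
    have h4 := Complex.imCLM.hasFDerivAt.comp_hasDerivAt t h3
    have h5 : HasDerivAt p _ t := h4.const_mul (-4 / l.im)
    have h6 := (Real.hasDerivAt_rpow_const (x := t) (p := ν + 1) (Or.inl ht.ne')).mul h5
    refine h6.congr_deriv ?_
    have hode := besselEntire_ode hν (t * l)
    rw [← hF] at hode
    have hode' : (t : ℂ) * (l * (deriv (deriv F) (t * l) * l)) =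
        -(ν + 1) * (l * deriv F (t * l)) - l * F (t * l) / 4 := by
      linear_combination l * hode
    set P := F (t * l)
    set D := deriv F (t * l)
    set E := l * (deriv (deriv F) (t * l) * l)
    have hpt : p t = -4 / l.im * (l * D * (starRingEnd ℂ) P).im := rfl
    rw [hpt, add_sub_cancel_right, Real.rpow_add_one ht.ne']
    have key : t * (E * star P + l * D * star (D * l)).im =
        -(ν + 1) * (l * D * star P).im - l.im / 4 * Complex.normSq P := by
      have h7 : (t : ℂ) * (E * star P + l * D * star (D * l)) =
          -(ν + 1) * (l * D * star P) - l / 4 * (Complex.normSq P : ℂ) +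
            (t * Complex.normSq (D * l) : ℝ) := by
        rw [← Complex.mul_conj, Complex.ofReal_mul, ← Complex.mul_conj]
        simp only [Complex.star_def]
        linear_combination (starRingEnd ℂ) P * hode'
      have h8 := congrArg Complex.im h7
      rw [Complex.im_ofReal_mul] at h8
      rw [h8, Complex.add_im, Complex.ofReal_im, Complex.sub_im, Complex.im_mul_ofReal, add_zero,
        show (-(ν + 1) : ℂ) = ((-(ν + 1) : ℝ) : ℂ) by push_cast; ring,
        Complex.im_ofReal_mul]
      simp
    rw [Complex.imCLM_apply]
    generalize (E * star P + l * D * star (D * l)).im = Y at key ⊢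
    rw [Complex.star_def] at key
    field_simp
    linear_combination (-4) * key
  · simp only [hp, Complex.ofReal_one, one_mul, hl]
    simp

theorem deriv_besselEntire_ne_zero {ν : ℝ} (hν : -1 < ν) {a : ℝ} (ha : 0 < a)
    (h0 : besselEntire ν a = 0) : deriv (besselEntire ν) a ≠ 0 := by
  intro h1
  set F := besselEntire ν with hF
  have hFd : Differentiable ℂ F := differentiable_besselEntire hν
  have hFd' : Differentiable ℂ (deriv F) := hFd.deriv
  have hfd : ∀ t : ℝ, HasDerivAt (fun t : ℝ => (F t).re) (deriv F t).re t := fun t =>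
    (hFd t).hasDerivAt.real_of_complex
  have hfd' : ∀ t : ℝ, HasDerivAt (fun t : ℝ => (deriv F t).re) (deriv (deriv F) t).re t :=
    fun t => (hFd' t).hasDerivAt.real_of_complex
  have hfc : Continuous fun t : ℝ => (F t).re :=
    continuous_iff_continuousAt.2 fun t => (hfd t).continuousAt
  have hfc' : Continuous fun t : ℝ => (deriv F t).re :=
    continuous_iff_continuousAt.2 fun t => (hfd' t).continuousAt
  -- This `p` makes `t^(ν+1) p` a primitive of `t^ν F²`, and it vanishes at a double zero.
  have := eq_zero_of_hasDerivAt_rpow_mul (g := fun t : ℝ => (F t).re ^ 2)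
    (p := fun t : ℝ => (F t).re ^ 2 + 4 * ν * ((F t).re * (deriv F t).re) +
      4 * (t * (deriv F t).re ^ 2)) hν ha (by fun_prop) (by fun_prop) (fun t => sq_nonneg _)
    (fun t ht => ?_) (by simp [h0, h1])
  · have h2 := re_besselEntire_pos_of_nonpos hν le_rfl
    rw [← hF] at h2
    exact (pow_pos h2 2).ne' this
  · have h2 := (((hfd t).pow 2).add (((hfd t).mul (hfd' t)).const_mul (4 * ν))).add
      (((hasDerivAt_id t).mul ((hfd' t).pow 2)).const_mul 4)
    have h3 := (Real.hasDerivAt_rpow_const (x := t) (p := ν + 1) (Or.inl ht.ne')).mul h2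
    refine h3.congr_deriv ?_
    have hode := congrArg Complex.re (besselEntire_ode hν t)
    rw [← hF] at hode
    have hode' : t * (deriv (deriv F) t).re + (ν + 1) * (deriv F t).re + (F t).re / 4 = 0 := by
      rw [Complex.add_re, Complex.add_re, Complex.re_ofReal_mul,
        show (ν + 1 : ℂ) = ((ν + 1 : ℝ) : ℂ) by push_cast; ring, Complex.re_ofReal_mul,
        show F t / 4 = F t / ((4 : ℝ) : ℂ) by norm_num, Complex.div_ofReal_re] at hode
      simpa using hode
    rw [add_sub_cancel_right, Real.rpow_add_one ht.ne']
    simp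
    linear_combination t ^ ν * (4 * ν * (F t).re + 8 * t * (deriv F t).re) * hode'

theorem exists_pos_of_besselEntire_eq_zero {ν : ℝ} (hν : -1 < ν) {z : ℂ}
    (hz : besselEntire ν z = 0) : ∃ x : ℝ, 0 < x ∧ z = x := by
  have hre : z = (z.re : ℂ) := Complex.ext rfl (by
    rw [im_eq_zero_of_besselEntire_eq_zero hν hz, Complex.ofReal_im])
  refine ⟨z.re, ?_, hre⟩
  by_contra! h
  have := re_besselEntire_pos_of_nonpos hν h
  rw [← hre, hz] at this
  simp at this

theorem deriv_besselEntire_ne_zero_of_eq_zero {ν : ℝ} (hν : -1 < ν) (z : ℂ)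
    (hz : besselEntire ν z = 0) : deriv (besselEntire ν) z ≠ 0 := by
  obtain ⟨x, hx, rfl⟩ := exists_pos_of_besselEntire_eq_zero hν hz
  exact deriv_besselEntire_ne_zero hν hx hz

/-! ### The sum over the remaining zeros -/

theorem besselJ_eq_zero_iff {ν x : ℝ} (hx : 0 < x) :
    besselJ ν x = 0 ↔ besselEntire ν ((x ^ 2 : ℝ) : ℂ) = 0 := by
  have h : besselJ ν x = (x / 2) ^ ν * ∑' m, besselCoeff ν m * (x ^ 2) ^ m := by
    rw [besselJ]
    congr 1
    refine tsum_congr fun m => ?_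
    rw [besselCoeff, div_mul_eq_mul_div, ← mul_pow, ← mul_pow]
    congr 2
    ring
  rw [h, besselEntire_ofReal, Complex.ofReal_eq_zero, mul_eq_zero_iff_left]
  exact (Real.rpow_pos_of_pos (by positivity) _).ne'

theorem hasSum_besselEntire_zeros {ν : ℝ} (hν : -1 < ν) {l : ℂ} (hl : besselEntire ν l = 0) :
    HasSum (fun s : {s : ℂ // besselEntire ν s = 0 ∧ s ≠ l} => 1 / (l - s))
      (-(ν + 1) / (2 * l)) := by
  set F := besselEntire ν with hF
  have hFd : Differentiable ℂ F := differentiable_besselEntire hν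
  have hs : ∀ z, F z = 0 → deriv F z ≠ 0 := deriv_besselEntire_ne_zero_of_eq_zero hν
  obtain ⟨hG, hfac, hGs, hGz⟩ := exists_dslope_factor hFd hs hl
  set G := dslope F l with hGdef
  have hl0 : l ≠ 0 := by
    rintro rfl
    exact besselEntire_zero_ne_zero hν hl
  have hF' : deriv F = fun z => G z + (z - l) * deriv G z := by
    funext z
    have h : HasDerivAt (fun w => (w - l) * G w) (1 * G z + (z - l) * deriv G z) z :=
      ((hasDerivAt_id z).sub_const l).mul (hG z).hasDerivAt
    rw [funext hfac, h.deriv, one_mul]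
  have hF'' : deriv (deriv F) l = 2 * deriv G l := by
    have h : HasDerivAt (fun w => G w + (w - l) * deriv G w)
        (deriv G l + (1 * deriv G l + (l - l) * deriv (deriv G) l)) l :=
      (hG l).hasDerivAt.add (((hasDerivAt_id l).sub_const l).mul (hG.deriv l).hasDerivAt)
    rw [hF', h.deriv]
    ring
  have hGl : G l ≠ 0 := fun h => ((hGz l).1 h).2 rfl
  have hlog : logDeriv G l = -(ν + 1) / (2 * l) := by
    have hode := besselEntire_ode hν l
    rw [← hF, hF'', hF', hl] at hode
    rw [logDeriv_apply, div_eq_div_iff hGl (by simpa using hl0)]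
    linear_combination hode
  have hG0 : G 0 ≠ 0 := fun h => besselEntire_zero_ne_zero hν ((hGz 0).1 h).1
  have hgr : ∀ ε > 0, ∃ C : ℝ, ∀ z, ‖G z‖ ≤ C * Real.exp (ε * ‖z‖) := by
    intro ε hε
    obtain ⟨C, hC⟩ := norm_besselEntire_le hν hε
    obtain ⟨B, hB⟩ := (isCompact_closedBall l 1).exists_bound_of_continuousOn
      hG.continuous.continuousOn
    refine ⟨max B C, fun z => ?_⟩
    rcases le_or_gt (dist z l) 1 with h | h
    · have h1 := hB z h
      calc ‖G z‖ ≤ B * 1 := by rwa [mul_one]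
        _ ≤ max B C * Real.exp (ε * ‖z‖) := by
          gcongr
          · exact ((norm_nonneg _).trans h1).trans (le_max_left _ _)
          · exact le_max_left _ _
          · exact Real.one_le_exp (by positivity)
    · have h1 := hC z
      rw [← hF, hfac, norm_mul, ← dist_eq_norm] at h1
      calc ‖G z‖ ≤ dist z l * ‖G z‖ := le_mul_of_one_le_left (norm_nonneg _) h.le
        _ ≤ C * Real.exp (ε * ‖z‖) := h1
        _ ≤ _ := by gcongr; exact le_max_right _ _
  have hsum := hasSum_logDeriv_of_pos_simple_zeros hG hGs hG0
    (fun z hz => exists_pos_of_besselEntire_eq_zero hν ((hGz z).1 hz).1) hgr hGl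
  rw [hlog] at hsum
  exact (Equiv.subtypeEquivRight hGz).hasSum_iff.1 hsum

theorem hasSum_besselJ_zeros {ν : ℝ} (hν : -1 < ν) {a : ℝ} (ha : 0 < a) (h0 : besselJ ν a = 0) :
    HasSum (fun x : {x : ℝ // (0 < x ∧ besselJ ν x = 0) ∧ x ≠ a} => 1 / ((x : ℝ) ^ 2 - a ^ 2))
      ((ν + 1) / (2 * a ^ 2)) := by
  have hsum := hasSum_besselEntire_zeros hν ((besselJ_eq_zero_iff ha).1 h0)
  let f : {x : ℝ // (0 < x ∧ besselJ ν x = 0) ∧ x ≠ a} →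
      {s : ℂ // besselEntire ν s = 0 ∧ s ≠ ((a ^ 2 : ℝ) : ℂ)} := fun x =>
    ⟨((x.1 ^ 2 : ℝ) : ℂ), (besselJ_eq_zero_iff x.2.1.1).1 x.2.1.2, fun h =>
      x.2.2 ((sq_eq_sq₀ x.2.1.1.le ha.le).1 (Complex.ofReal_injective h))⟩
  have hf : Function.Bijective f := by
    constructor
    · intro x y hxy
      exact Subtype.ext ((sq_eq_sq₀ x.2.1.1.le y.2.1.1.le).1
        (Complex.ofReal_injective (congrArg Subtype.val hxy)))
    · rintro ⟨s, hs, hne⟩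
      obtain ⟨y, hy, rfl⟩ := exists_pos_of_besselEntire_eq_zero hν hs
      have hsq : √y ^ 2 = y := Real.sq_sqrt hy.le
      refine ⟨⟨√y, ⟨Real.sqrt_pos.2 hy, ?_⟩, ?_⟩, ?_⟩
      · rwa [besselJ_eq_zero_iff (Real.sqrt_pos.2 hy), hsq]
      · rintro rfl
        exact hne (by rw [hsq])
      · exact Subtype.ext (congrArg Complex.ofReal hsq)
  have h1 := ((Equiv.ofBijective f hf).hasSum_iff.2 hsum).neg
  rw [← Complex.hasSum_ofReal]
  have hval : (((ν + 1) / (2 * a ^ 2) : ℝ) : ℂ) = -(-(ν + 1) / (2 * ((a ^ 2 : ℝ) : ℂ))) := by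
    push_cast
    ring
  rw [hval]
  refine h1.congr_fun fun x => ?_
  simp only [Function.comp_apply, Equiv.ofBijective_apply, f]
  push_cast
  rw [← neg_sub, div_neg]

/-! ### Existence and enumeration of the zeros -/

theorem finite_besselJ_zeros_lt {ν : ℝ} (hν : -1 < ν) (B : ℝ) :
    {x : ℝ | (0 < x ∧ besselJ ν x = 0) ∧ x < B}.Finite := by
  refine Set.Finite.of_finite_image (f := fun x : ℝ => ((x ^ 2 : ℝ) : ℂ))
    ((finite_zeros_norm_lt (differentiable_besselEntire hν) (besselEntire_zero_ne_zero hν)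
      (B ^ 2)).subset ?_) ?_
  · rintro _ ⟨x, ⟨⟨hx, h0⟩, hB⟩, rfl⟩
    refine ⟨(besselJ_eq_zero_iff hx).1 h0, ?_⟩
    rw [Complex.norm_real, Real.norm_of_nonneg (sq_nonneg x)]
    gcongr
  · intro x hx y hy hxy
    exact (sq_eq_sq₀ hx.1.1.le hy.1.1.le).1 (Complex.ofReal_injective hxy)

theorem exists_besselJ_zero {ν : ℝ} (hν : -1 < ν) : ∃ x, 0 < x ∧ besselJ ν x = 0 := by
  by_contra! hno
  have hempty : IsEmpty {s : ℂ // besselEntire ν s = 0} := by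
    refine ⟨fun ⟨s, hs⟩ => ?_⟩
    obtain ⟨y, hy, rfl⟩ := exists_pos_of_besselEntire_eq_zero hν hs
    refine hno _ (Real.sqrt_pos.2 hy) ?_
    rwa [besselJ_eq_zero_iff (Real.sqrt_pos.2 hy), Real.sq_sqrt hy.le]
  have h0 := besselEntire_zero_ne_zero hν
  have hsum := hasSum_logDeriv_of_pos_simple_zeros (differentiable_besselEntire hν)
    (deriv_besselEntire_ne_zero_of_eq_zero hν) h0
    (fun _ h => exists_pos_of_besselEntire_eq_zero hν h) (fun _ h => norm_besselEntire_le hν h) h0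
  have h1 := hsum.unique hasSum_empty
  rw [logDeriv_apply, deriv_besselEntire hν] at h1
  simp [h0, besselEntire_zero_ne_zero (show -1 < ν + 1 by linarith)] at h1

theorem exists_besselJ_zero_gt {ν : ℝ} (hν : -1 < ν) {a : ℝ} (ha : 0 < a) (h0 : besselJ ν a = 0) :
    ∃ x, a < x ∧ besselJ ν x = 0 := by
  by_contra! hno
  have h1 := hasSum_le (fun x : {x : ℝ // (0 < x ∧ besselJ ν x = 0) ∧ x ≠ a} => ?_)
    (hasSum_besselJ_zeros hν ha h0) hasSum_zero
  · have : 0 < (ν + 1) / (2 * a ^ 2) := div_pos (by linarith) (by positivity)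
    linarith
  · obtain ⟨x, ⟨hx, hx0⟩, -⟩ := x
    have hle : x ≤ a := not_lt.1 fun h => hno x h hx0
    exact one_div_nonpos.2 (sub_nonpos.2 (by gcongr))

/-- A further zero exists and only finitely many lie below any bound, so the infimum is attained.
The disjunction covers the start `j_{ν,0} = 0`, which need not be a zero. -/
theorem besselZero_spec {ν : ℝ} (hν : -1 < ν) {n : ℕ}
    (h : besselZero ν n = 0 ∨ 0 < besselZero ν n ∧ besselJ ν (besselZero ν n) = 0) :
    IsLeast {x : ℝ | besselZero ν n < x ∧ besselJ ν x = 0} (besselZero ν (n + 1)) := by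
  have hnn : 0 ≤ besselZero ν n := by
    rcases h with h | h
    · exact h.ge
    · exact h.1.le
  obtain ⟨y, hy⟩ : ∃ x, besselZero ν n < x ∧ besselJ ν x = 0 := by
    rcases h with h | h
    · rw [h]; exact exists_besselJ_zero hν
    · exact exists_besselJ_zero_gt hν h.1 h.2
  have hfin : {x : ℝ | (besselZero ν n < x ∧ besselJ ν x = 0) ∧ x < y + 1}.Finite :=
    (finite_besselJ_zeros_lt hν (y + 1)).subset fun x hx => ⟨⟨hnn.trans_lt hx.1.1, hx.1.2⟩, hx.2⟩
  obtain ⟨m, hm⟩ := hfin.exists_minimal ⟨y, hy, lt_add_one y⟩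
  have hleast : IsLeast {x : ℝ | besselZero ν n < x ∧ besselJ ν x = 0} m := by
    refine ⟨hm.1.1, fun x hx => ?_⟩
    by_contra! hlt
    exact hlt.not_ge (hm.2 ⟨hx, hlt.trans hm.1.2⟩ hlt.le)
  rw [besselZero, hleast.csInf_eq]
  exact hleast

theorem besselZero_succ_mem {ν : ℝ} (hν : -1 < ν) (n : ℕ) :
    0 < besselZero ν (n + 1) ∧ besselJ ν (besselZero ν (n + 1)) = 0 := by
  induction n with
  | zero => exact (besselZero_spec (n := 0) hν (Or.inl rfl)).1
  | succ n ih =>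
    have h := (besselZero_spec hν (Or.inr ih)).1
    exact ⟨ih.1.trans h.1, h.2⟩

theorem isLeast_besselZero_succ {ν : ℝ} (hν : -1 < ν) (n : ℕ) :
    IsLeast {x : ℝ | besselZero ν n < x ∧ besselJ ν x = 0} (besselZero ν (n + 1)) := by
  cases n with
  | zero => exact besselZero_spec hν (Or.inl rfl)
  | succ n => exact besselZero_spec hν (Or.inr (besselZero_succ_mem hν n))

theorem strictMono_besselZero {ν : ℝ} (hν : -1 < ν) : StrictMono (besselZero ν) :=
  strictMono_nat_of_lt_succ fun n => (isLeast_besselZero_succ hν n).1.1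

theorem besselZero_mem {ν : ℝ} (hν : -1 < ν) {n : ℕ} (hn : 1 ≤ n) :
    0 < besselZero ν n ∧ besselJ ν (besselZero ν n) = 0 := by
  obtain ⟨n, rfl⟩ := Nat.exists_eq_add_of_le' hn
  exact besselZero_succ_mem hν n

theorem exists_besselZero_eq {ν : ℝ} (hν : -1 < ν) {x : ℝ} (hx : 0 < x) (h0 : besselJ ν x = 0) :
    ∃ n, 1 ≤ n ∧ besselZero ν n = x := by
  by_contra! hno
  have hlt : ∀ n, besselZero ν n < x := by
    intro n
    induction n with
    | zero => exact hx
    | succ n ih =>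
      exact lt_of_le_of_ne ((isLeast_besselZero_succ hν n).2 ⟨ih, h0⟩) (hno _ (by omega))
  -- A missed zero `x` would have infinitely many zeros below it; the shift by one skips the
  -- conventional index 0.
  refine Set.infinite_of_injective_forall_mem
    ((strictMono_besselZero hν).injective.comp (add_left_injective 1))
    (fun n => ?_) (finite_besselJ_zeros_lt hν x)
  exact ⟨besselZero_succ_mem hν n, hlt (n + 1)⟩

theorem mainTheorem4 (ν : ℝ) (hν : -1 < ν) :
    -- the numbers `j_{ν,n}`, `n ≥ 1`, increase strictly and are exactly the positive zeros of `J_ν`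
    StrictMonoOn (besselZero ν) (Set.Ici 1) ∧
    besselZero ν '' Set.Ici 1 = {x : ℝ | 0 < x ∧ besselJ ν x = 0} ∧
    -- Calogero's identity, the series converging absolutely
    ∀ k : ℕ, 1 ≤ k →
      HasSum (fun n : {n : ℕ // 1 ≤ n ∧ n ≠ k} =>
          1 / (besselZero ν (n : ℕ) ^ 2 - besselZero ν k ^ 2))
        ((ν + 1) / (2 * besselZero ν k ^ 2)) := by
  refine ⟨(strictMono_besselZero hν).strictMonoOn _, ?_, fun k hk => ?_⟩
  · ext x
    constructor
    · rintro ⟨n, hn, rfl⟩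
      exact besselZero_mem hν hn
    · rintro ⟨hx, h0⟩
      exact exists_besselZero_eq hν hx h0
  · have hinj := (strictMono_besselZero hν).injective
    let f : {n : ℕ // 1 ≤ n ∧ n ≠ k} →
        {x : ℝ // (0 < x ∧ besselJ ν x = 0) ∧ x ≠ besselZero ν k} := fun n =>
      ⟨besselZero ν n, besselZero_mem hν n.2.1, fun h => n.2.2 (hinj h)⟩
    have hf : Function.Bijective f := by
      constructor
      · intro m n hmn
        exact Subtype.ext (hinj (congrArg Subtype.val hmn))
      · rintro ⟨x, ⟨hx, h0⟩, hne⟩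
        obtain ⟨n, hn, rfl⟩ := exists_besselZero_eq hν hx h0
        exact ⟨⟨n, hn, fun h => hne (by rw [h])⟩, rfl⟩
    obtain ⟨hpos, h0⟩ := besselZero_mem hν hk
    exact (Equiv.ofBijective f hf).hasSum_iff.2 (hasSum_besselJ_zeros hν hpos h0)
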